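/- Let $n\in\mathbb{N}$, let $\mathbb{R}^n$ carry the Euclidean norm, and let $g:\mathbb{R}^n\to\mathbb{R}$ be Fréchet differentiable, bounded from below, with (globally) Lipschitz continuous gradient. Let $t_0>0$, $\lambda>0$, $\gamma>0$ and $u_0,v_0\in\mathbb{R}^n$, and let $x:[t_0,+\infty)\to\mathbb{R}^n$ be the strong global solution of $$\frac{\lambda}{t^2}\ddot x(t)+\frac{\gamma}{t}\dot x(t)+\nabla g(x(t))=0,\qquad x(t_0)=u_0,\quad \dot x(t_0)=v_0,$$ that is, $x,\dot x,\ddot x$ exist and are absolutely continuous on $[t_0,b]$ for every $b>t_0$, the initial conditions hold, and the equation holds for almost every $t\ge t_0$. Suppose that $x$ is bounded on $[t_0,+\infty)$ and that $\lim_{t\to+\infty}x(t)=\overline x$, where $\nabla g(\overline x)=0$. Suppose further that $g$ has the Łojasiewicz property at $\overline x$ with exponent $\theta\in\left[\tfrac12,1\right)$, that is, there are $K,\varepsilon>0$ such that $$|g(y)-g(\overline x)|^{\theta}\le K\,\|\nabla g(y)\|\quad\text{for every } y\in\mathbb{R}^n \text{ with } \|y-\overline x\|<\varepsilon.$$ Then: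 - if $\theta=\tfrac12$, there exist $a_1,a_2>0$ and $t'\ge t_0$ such that $\|x(t)-\overline x\|\le a_1e^{-a_2t^2}$ for every $t\ge t'$; - if $\theta\in\left(\tfrac12,1\right)$, there exist $a_3,a_4>0$ and $t'\ge t_0$ such that $\|x(t)-\overline x\|\le (a_3t^2+a_4)^{-\frac{1-\theta}{2\theta-1}}$ for every $t\ge t'$. -/

import Mathlib

open Set Filter Topology MeasureTheory

namespace UnboundedDamping

/-- The set of critical points `crit f = {x : ∇f(x) = 0}` of a function on `ℝⁿ`. -/
def crit {n : ℕ} (f : EuclideanSpace ℝ (Fin n) → ℝ) : Set (EuclideanSpace ℝ (Fin n)) :=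
  {x | gradient f x = 0}

/-- `f` fulfills the Łojasiewicz property at the point `xbar` with exponent `θ ∈ (0, 1)`. -/
def HasLojasiewiczExponentAt {n : ℕ} (f : EuclideanSpace ℝ (Fin n) → ℝ)
    (xbar : EuclideanSpace ℝ (Fin n)) (θ : ℝ) : Prop :=
  θ ∈ Ioo (0 : ℝ) 1 ∧ ∃ K > (0 : ℝ), ∃ ε > (0 : ℝ), ∀ x : EuclideanSpace ℝ (Fin n),
    ‖x - xbar‖ < ε → |f x - f xbar| ^ θ ≤ K * ‖gradient f x‖

/-- Local absolute continuity on `[t₀, ∞)`: absolute continuity (in the `ε`-`η` sense) on every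
compact interval `[t₀, b]`. -/
def LocallyAbsolutelyContinuousFrom {n : ℕ} (t₀ : ℝ) (f : ℝ → EuclideanSpace ℝ (Fin n)) : Prop :=
  ∀ b > t₀, AbsolutelyContinuousOnInterval f t₀ b

/-- The first derivative on `[t₀, ∞)` (one-sided at `t₀`). -/
noncomputable def vel {n : ℕ} (t₀ : ℝ) (x : ℝ → EuclideanSpace ℝ (Fin n)) :
    ℝ → EuclideanSpace ℝ (Fin n) :=
  derivWithin x (Ici t₀)

/-- The second derivative on `[t₀, ∞)` (one-sided at `t₀`). -/
noncomputable def acc {n : ℕ} (t₀ : ℝ) (x : ℝ → EuclideanSpace ℝ (Fin n)) :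
    ℝ → EuclideanSpace ℝ (Fin n) :=
  vel t₀ (vel t₀ x)

/-- `x` (only its values on `[t₀, ∞)` matter) is a strong global solution of
`(lam / t²) x''(t) + (γ / t) x'(t) + ∇g(x(t)) = 0`, `x(t₀) = u₀`, `x'(t₀) = v₀`. -/
structure IsStrongGlobalSolution {n : ℕ} (g : EuclideanSpace ℝ (Fin n) → ℝ) (lam γ t₀ : ℝ)
    (u₀ v₀ : EuclideanSpace ℝ (Fin n)) (x : ℝ → EuclideanSpace ℝ (Fin n)) : Prop where
  /-- `x'` exists on `[t₀, ∞)`. -/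
  differentiableOn : DifferentiableOn ℝ x (Ici t₀)
  /-- `x''` exists on `[t₀, ∞)`. -/
  differentiableOn_vel : DifferentiableOn ℝ (vel t₀ x) (Ici t₀)
  locAC : LocallyAbsolutelyContinuousFrom t₀ x
  locAC_vel : LocallyAbsolutelyContinuousFrom t₀ (vel t₀ x)
  locAC_acc : LocallyAbsolutelyContinuousFrom t₀ (acc t₀ x)
  ode : ∀ᵐ t ∂(volume.restrict (Ici t₀)),
    (lam / t ^ 2) • acc t₀ x t + (γ / t) • vel t₀ x t + gradient g (x t) = 0
  init_pos : x t₀ = u₀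
  init_vel : vel t₀ x t₀ = v₀

end UnboundedDamping

/-! ### Decay rates from a Lyapunov function satisfying a Łojasiewicz-type inequality. -/

namespace UnboundedDamping

/-! In the time `s = t² / 2` the equation becomes `y'' + b(s) y' + μ ∇g(y) = 0` with `μ = 1 / lam`
and `b(s) = γ / lam + 1 / (2 s)`, a damping pinched between two positive constants
(`IsStrongGlobalSolution.hasDerivAt_rescaled`). Heavy-ball rates in `s` are then rates in `t²`.

With `v = y'`, `W = ‖∇g(y)‖ + ‖v‖` and small `β`, the function `h = g(y + β v) - g(z) + ‖v‖² / (2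
μ)` satisfies `h' ≤ -c W²` and `h ^ θ ≤ M W` for large `s` (`exists_lyapunov`), and it tends to `0`.
Either `h` vanishes from some time on and the curve rests at its limit, or `h > 0`. In the latter
case `h' ≤ -(c / M²) h ^ (2θ)` makes `h` decay exponentially (`θ = 1/2`) or polynomially (`θ >
1/2`), while `‖v‖ ≤ W` is dominated by a multiple of `-(h ^ (1 - θ))'`, so the remaining length,
hence `‖y - z‖`, is at most `C h ^ (1 - θ)` (`norm_sub_le_rpow_of_lojasiewicz`). -/

/-- A real function with nonpositive derivative on `(a, ∞)` is antitone there. -/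
theorem antitoneOn_Ioi_of_hasDerivAt {h h' : ℝ → ℝ} {a : ℝ}
    (hd : ∀ s > a, HasDerivAt h (h' s) s) (hn : ∀ s > a, h' s ≤ 0) : AntitoneOn h (Ioi a) := by
  refine antitoneOn_of_deriv_nonpos (convex_Ioi a)
    (fun s hs => (hd s hs).continuousAt.continuousWithinAt) ?_ ?_
  · rw [interior_Ioi]
    exact fun s hs => (hd s hs).differentiableAt.differentiableWithinAt
  · rw [interior_Ioi]
    intro s hs
    rw [(hd s hs).deriv]
    exact hn s hs

theorem nonneg_of_antitoneOn_of_tendsto_zero {h : ℝ → ℝ} {a : ℝ} (ha : AntitoneOn h (Ioi a))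
    (h0 : Tendsto h atTop (𝓝 0)) {s : ℝ} (hs : a < s) : 0 ≤ h s := by
  refine le_of_tendsto h0 ?_
  filter_upwards [eventually_ge_atTop s] with T hT
  exact ha hs (lt_of_lt_of_le hs hT) hT

/-- A curve whose speed is dominated by the decrease of a nonnegative function `φ` stays within
`φ s` of its limit. -/
theorem norm_sub_le_of_norm_deriv_le {F : Type*} [NormedAddCommGroup F] [NormedSpace ℝ F]
    {y v : ℝ → F} {φ φ' : ℝ → ℝ} {a : ℝ} {z : F}
    (hy : ∀ s > a, HasDerivAt y (v s) s) (hφ : ∀ s > a, HasDerivAt φ (φ' s) s)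
    (hle : ∀ s > a, ‖v s‖ ≤ -φ' s) (hpos : ∀ s > a, 0 ≤ φ s)
    (hlim : Tendsto y atTop (𝓝 z)) {s : ℝ} (hs : a < s) : ‖y s - z‖ ≤ φ s := by
  have key : ∀ T ≥ s, ‖y T - y s‖ ≤ φ s := by
    intro T hT
    have h1 := image_norm_le_of_norm_deriv_right_le_deriv_boundary' (f := fun r => y r - y s)
      (f' := v) (a := s) (b := T) (B := fun r => φ s - φ r) (B' := fun r => -φ' r)
      (fun r hr => ((hy r (lt_of_lt_of_le hs hr.1)).sub_const _).continuousAt.continuousWithinAt)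
      (fun r hr => ((hy r (lt_of_lt_of_le hs hr.1)).sub_const _).hasDerivWithinAt)
      (by simp)
      (fun r hr => ((hφ r (lt_of_lt_of_le hs hr.1)).const_sub _).continuousAt.continuousWithinAt)
      (fun r hr => ((hφ r (lt_of_lt_of_le hs hr.1)).const_sub _).hasDerivWithinAt)
      (fun r hr => hle r (lt_of_lt_of_le hs hr.1))
      (right_mem_Icc.2 hT)
    have h2 := hpos T (lt_of_lt_of_le hs hT)
    linarith
  have h3 : Tendsto (fun T => ‖y T - y s‖) atTop (𝓝 ‖z - y s‖) :=
    (hlim.sub_const _).norm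
  rw [norm_sub_rev]
  refine le_of_tendsto h3 ?_
  filter_upwards [eventually_ge_atTop s] with T hT using key T hT

/-- Either a curve is eventually at its limit, or its Lyapunov function is positive. -/
theorem eventually_eq_or_forall_pos {F : Type*} [NormedAddCommGroup F] [NormedSpace ℝ F]
    {y v : ℝ → F} {h h' W : ℝ → ℝ} {a c : ℝ} {z : F} (hc : 0 < c)
    (hy : ∀ s > a, HasDerivAt y (v s) s) (hh : ∀ s > a, HasDerivAt h (h' s) s)
    (hdec : ∀ s > a, h' s ≤ -c * W s ^ 2) (hvW : ∀ s > a, ‖v s‖ ≤ W s)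
    (h0 : Tendsto h atTop (𝓝 0)) (hlim : Tendsto y atTop (𝓝 z)) :
    (∃ S > a, ∀ s > S, y s = z) ∨ ∀ s > a, 0 < h s := by
  have hanti : AntitoneOn h (Ioi a) := antitoneOn_Ioi_of_hasDerivAt hh fun s hs =>
    (hdec s hs).trans (by nlinarith [sq_nonneg (W s)])
  by_cases hp : ∀ s > a, 0 < h s
  · exact Or.inr hp
  left
  push Not at hp
  obtain ⟨S, hS, hS0⟩ := hp
  refine ⟨S, hS, fun s hs => ?_⟩
  have hz : ∀ r > S, h r = 0 := fun r hr => le_antisymm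
    ((hanti hS (hS.trans hr) hr.le).trans hS0)
    (nonneg_of_antitoneOn_of_tendsto_zero hanti h0 (hS.trans hr))
  have hv0 : ∀ r > S, ‖v r‖ ≤ -(0 : ℝ) := by
    intro r hr
    have e : h =ᶠ[𝓝 r] fun _ => 0 := by
      filter_upwards [Ioi_mem_nhds hr] with q hq using hz q hq
    have e2 : h' r = 0 :=
      (hh r (hS.trans hr)).unique ((hasDerivAt_const r (0 : ℝ)).congr_of_eventuallyEq e)
    have e3 := hdec r (hS.trans hr)
    have e4 := hvW r (hS.trans hr)
    have e5 : W r ^ 2 ≤ 0 := by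
      by_contra hneg
      push Not at hneg
      nlinarith
    have e6 : W r = 0 := pow_eq_zero_iff two_ne_zero |>.1 (le_antisymm e5 (sq_nonneg _))
    linarith
  have := norm_sub_le_of_norm_deriv_le (φ := fun _ => (0 : ℝ)) (φ' := fun _ => 0)
    (fun r hr => hy r (hS.trans hr)) (fun r _ => hasDerivAt_const r (0 : ℝ)) hv0
    (fun _ _ => le_rfl) hlim hs
  exact sub_eq_zero.1 (norm_le_zero_iff.1 this)

/-- The finite-length estimate of the Łojasiewicz argument. -/
theorem norm_sub_le_rpow_of_lojasiewicz {F : Type*} [NormedAddCommGroup F] [NormedSpace ℝ F]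
    {y v : ℝ → F} {h h' W : ℝ → ℝ} {a c M θ : ℝ} {z : F} (hc : 0 < c) (hM : 0 < M) (hθ1 : θ < 1)
    (hy : ∀ s > a, HasDerivAt y (v s) s) (hh : ∀ s > a, HasDerivAt h (h' s) s)
    (hdec : ∀ s > a, h' s ≤ -c * W s ^ 2) (hvW : ∀ s > a, ‖v s‖ ≤ W s)
    (hL : ∀ s > a, h s ^ θ ≤ M * W s) (hpos : ∀ s > a, 0 < h s)
    (hlim : Tendsto y atTop (𝓝 z)) {s : ℝ} (hs : a < s) :
    ‖y s - z‖ ≤ M / (c * (1 - θ)) * h s ^ (1 - θ) := by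
  have h1θ : 0 < 1 - θ := by linarith
  refine norm_sub_le_of_norm_deriv_le (φ := fun s => M / (c * (1 - θ)) * h s ^ (1 - θ))
    (φ' := fun s => M / (c * (1 - θ)) * (h' s * (1 - θ) * h s ^ (1 - θ - 1))) hy
    (fun r hr => ((hh r hr).rpow_const (Or.inl (hpos r hr).ne')).const_mul _) ?_
    (fun r hr => mul_nonneg (by positivity) (Real.rpow_nonneg (hpos r hr).le _)) hlim hs
  intro r hr
  have hp := hpos r hr
  -- The derivative of `h ^ (1 - θ)` is `(1 - θ) h' h ^ (-θ)`, and `-h' h ^ (-θ) ≥ c W² / (M W) = c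
  -- W / M`.
  have e1 : h r ^ (1 - θ - 1) = (h r ^ θ)⁻¹ := by
    rw [← Real.rpow_neg hp.le]; congr 1; ring
  have hq : 0 < h r ^ θ := Real.rpow_pos_of_pos hp _
  have hW : 0 ≤ W r := (norm_nonneg _).trans (hvW r hr)
  rw [e1]
  have e2 : -(M / (c * (1 - θ)) * (h' r * (1 - θ) * (h r ^ θ)⁻¹)) = M * (-h' r) / (c * h r ^ θ) := by
    field_simp
  rw [e2, le_div_iff₀ (by positivity)]
  have e3 := hdec r hr
  have e4 := hL r hr
  have e5 := hvW r hr
  calc ‖v r‖ * (c * h r ^ θ) ≤ W r * (c * (M * W r)) := by gcongr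
    _ = M * (c * W r ^ 2) := by ring
    _ ≤ M * (-h' r) := by gcongr; linarith

/-- Grönwall by integrating factor: `h s * exp (c s)` is nonincreasing. -/
theorem le_exp_of_deriv_le {h h' : ℝ → ℝ} {a c : ℝ} (hh : ∀ s > a, HasDerivAt h (h' s) s)
    (hdec : ∀ s > a, h' s ≤ -c * h s) {S s : ℝ} (hS : a < S) (hs : S ≤ s) :
    h s ≤ h S * Real.exp (c * S) * Real.exp (-c * s) := by
  have hd : ∀ s > a, HasDerivAt (fun s => h s * Real.exp (c * s))
      (h' s * Real.exp (c * s) + h s * (Real.exp (c * s) * c)) s := fun s hs => by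
    have := (((hasDerivAt_id s).const_mul c).exp)
    simp only [id, mul_one] at this
    exact (hh s hs).mul this
  have hanti := antitoneOn_Ioi_of_hasDerivAt hd fun s hs => by
    have := hdec s hs
    nlinarith [Real.exp_pos (c * s)]
  have h1 := hanti hS (lt_of_lt_of_le hS hs) hs
  simp only at h1
  calc h s = h s * Real.exp (c * s) * Real.exp (-c * s) := by
        rw [mul_assoc, ← Real.exp_add]; simp
    _ ≤ _ := by gcongr

/-- Separation of variables: `(h ^ (-q))' ≥ q c`, so `h ^ (-q)` grows at least linearly. -/
theorem le_rpow_of_deriv_le {h h' : ℝ → ℝ} {a c q : ℝ} (hc : 0 < c) (hq : 0 < q)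
    (hh : ∀ s > a, HasDerivAt h (h' s) s) (hpos : ∀ s > a, 0 < h s)
    (hdec : ∀ s > a, h' s ≤ -c * h s ^ (1 + q)) {S s : ℝ} (hS : a < S) (hs : S < s) :
    h s ≤ (q * c * (s - S)) ^ (-(1 / q)) := by
  have hd : ∀ s > a, HasDerivAt (fun s => q * c * s - h s ^ (-q))
      (q * c * 1 - h' s * (-q) * h s ^ (-q - 1)) s := fun s hs =>
    ((hasDerivAt_id s).const_mul _).sub ((hh s hs).rpow_const (Or.inl (hpos s hs).ne'))
  have hanti := antitoneOn_Ioi_of_hasDerivAt hd fun s hs => by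
    have h1 := hdec s hs
    have hp := hpos s hs
    have e : h s ^ (1 + q) * h s ^ (-q - 1) = 1 := by
      rw [← Real.rpow_add hp]; ring_nf; simp
    have e2 : 0 < h s ^ (-q - 1) := Real.rpow_pos_of_pos hp _
    have e3 : h' s * h s ^ (-q - 1) ≤ -c := by
      calc h' s * h s ^ (-q - 1) ≤ -c * h s ^ (1 + q) * h s ^ (-q - 1) := by gcongr
        _ = -c := by rw [mul_assoc, e, mul_one]
    nlinarith
  have h1 := hanti hS (hS.trans hs) hs.le
  simp only at h1
  have hps := hpos s (hS.trans hs)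
  have hpS := Real.rpow_pos_of_pos (hpos S hS) (-q)
  have hz : 0 < q * c * (s - S) := by have := sub_pos.2 hs; positivity
  have h2 : q * c * (s - S) ≤ h s ^ (-q) := by nlinarith
  calc h s = (h s ^ (-q)) ^ (-(1 / q)) := by
        rw [← Real.rpow_mul hps.le]; field_simp; simp
    _ ≤ _ := Real.rpow_le_rpow_of_nonpos hz h2 (by simp only [one_div, Left.neg_nonpos_iff]; positivity)

/-- Exponential rate of a curve admitting a Łojasiewicz-type Lyapunov function, exponent `1/2`. -/
theorem exp_rate_of_lojasiewicz {F : Type*} [NormedAddCommGroup F] [NormedSpace ℝ F]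
    {y v : ℝ → F} {h h' W : ℝ → ℝ} {a c M : ℝ} {z : F} (hc : 0 < c) (hM : 0 < M)
    (hy : ∀ s > a, HasDerivAt y (v s) s) (hh : ∀ s > a, HasDerivAt h (h' s) s)
    (hdec : ∀ s > a, h' s ≤ -c * W s ^ 2) (hvW : ∀ s > a, ‖v s‖ ≤ W s)
    (hL : ∀ s > a, h s ^ (1 / 2 : ℝ) ≤ M * W s)
    (h0 : Tendsto h atTop (𝓝 0)) (hlim : Tendsto y atTop (𝓝 z)) :
    ∃ C > 0, ∃ k > 0, ∃ S : ℝ, ∀ s > S, ‖y s - z‖ ≤ C * Real.exp (-k * s) := by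
  rcases eventually_eq_or_forall_pos hc hy hh hdec hvW h0 hlim with ⟨S, -, hS⟩ | hpos
  · exact ⟨1, one_pos, 1, one_pos, S, fun s hs => by simp [hS s hs, (Real.exp_pos _).le]⟩
  have hdec2 : ∀ s > a, h' s ≤ -(c / M ^ 2) * h s := fun s hs => by
    have hp := hpos s hs
    have e1 : h s ≤ (M * W s) ^ 2 := by
      calc h s = (h s ^ (1 / 2 : ℝ)) ^ 2 := by
            rw [← Real.sqrt_eq_rpow, Real.sq_sqrt hp.le]
        _ ≤ _ := pow_le_pow_left₀ (Real.rpow_nonneg hp.le _) (hL s hs) 2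
    calc h' s ≤ -c * W s ^ 2 := hdec s hs
      _ = -(c / M ^ 2 * (M * W s) ^ 2) := by field_simp
      _ ≤ -(c / M ^ 2 * h s) := by gcongr
      _ = _ := by ring
  set k := c / M ^ 2
  have hk : 0 < k := by positivity
  have hpS := hpos (a + 1) (by linarith)
  set D := h (a + 1) * Real.exp (k * (a + 1))
  have hD : 0 < D := by positivity
  refine ⟨M / (c * (1 - 1 / 2)) * D ^ (1 / 2 : ℝ), by norm_num; positivity, k / 2, by positivity,
    a + 1, fun s hs => ?_⟩
  have has : a < s := by linarith
  have h1 := le_exp_of_deriv_le hh hdec2 (lt_add_one a) (le_of_lt hs)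
  have h2 := norm_sub_le_rpow_of_lojasiewicz hc hM (by norm_num) hy hh hdec hvW hL hpos hlim has
  have hp := hpos s has
  refine h2.trans ?_
  rw [mul_assoc]
  refine mul_le_mul_of_nonneg_left ?_ (by norm_num; positivity)
  calc h s ^ (1 - 1 / 2 : ℝ) = h s ^ (1 / 2 : ℝ) := by norm_num
    _ ≤ (D * Real.exp (-k * s)) ^ (1 / 2 : ℝ) := Real.rpow_le_rpow hp.le h1 (by norm_num)
    _ = D ^ (1 / 2 : ℝ) * Real.exp (-(k / 2) * s) := by
      rw [Real.mul_rpow hD.le (Real.exp_pos _).le, ← Real.exp_mul]; congr 2; ring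

/-- Polynomial rate of a curve admitting a Łojasiewicz-type Lyapunov function, exponent in
`(1/2, 1)`. -/
theorem rpow_rate_of_lojasiewicz {F : Type*} [NormedAddCommGroup F] [NormedSpace ℝ F]
    {y v : ℝ → F} {h h' W : ℝ → ℝ} {a c M θ : ℝ} {z : F} (hc : 0 < c) (hM : 0 < M)
    (hθ : 1 / 2 < θ) (hθ1 : θ < 1)
    (hy : ∀ s > a, HasDerivAt y (v s) s) (hh : ∀ s > a, HasDerivAt h (h' s) s)
    (hdec : ∀ s > a, h' s ≤ -c * W s ^ 2) (hvW : ∀ s > a, ‖v s‖ ≤ W s)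
    (hL : ∀ s > a, h s ^ θ ≤ M * W s)
    (h0 : Tendsto h atTop (𝓝 0)) (hlim : Tendsto y atTop (𝓝 z)) :
    ∃ k > 0, ∃ S : ℝ, ∀ s > S, ‖y s - z‖ ≤ (k * (s - S)) ^ (-((1 - θ) / (2 * θ - 1))) := by
  rcases eventually_eq_or_forall_pos hc hy hh hdec hvW h0 hlim with ⟨S, -, hS⟩ | hpos
  · refine ⟨1, one_pos, S, fun s hs => ?_⟩
    have : 0 ≤ 1 * (s - S) := by linarith
    rw [hS s hs, sub_self, norm_zero]
    positivity
  have hq : 0 < 2 * θ - 1 := by linarith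
  have h1θ : 0 < 1 - θ := by linarith
  have hdec2 : ∀ s > a, h' s ≤ -(c / M ^ 2) * h s ^ (1 + (2 * θ - 1)) := fun s hs => by
    have hp := hpos s hs
    have e1 : h s ^ (1 + (2 * θ - 1)) ≤ (M * W s) ^ 2 := by
      calc h s ^ (1 + (2 * θ - 1)) = (h s ^ θ) ^ 2 := by
            rw [← Real.rpow_natCast, ← Real.rpow_mul hp.le]; congr 1; push_cast; ring
        _ ≤ _ := pow_le_pow_left₀ (Real.rpow_nonneg hp.le _) (hL s hs) 2
    calc h' s ≤ -c * W s ^ 2 := hdec s hs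
      _ = -(c / M ^ 2 * (M * W s) ^ 2) := by field_simp
      _ ≤ -(c / M ^ 2 * h s ^ (1 + (2 * θ - 1))) := by gcongr
      _ = _ := by ring
  set q := 2 * θ - 1
  set k := q * (c / M ^ 2) with hk_def
  have hk : 0 < k := by positivity
  set C := M / (c * (1 - θ))
  have hC : 0 < C := by positivity
  set p := (1 - θ) / q with hp_def
  have hp0 : 0 < p := by positivity
  -- The factor `C ^ (-(1 / p))` absorbs the prefactor `C` into the power `-p`.
  refine ⟨C ^ (-(1 / p)) * k, by positivity, a + 1, fun s hs => ?_⟩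
  have has : a < s := by linarith
  have h1 := le_rpow_of_deriv_le (by positivity) hq hh hpos hdec2 (lt_add_one a) hs
  have h2 := norm_sub_le_rpow_of_lojasiewicz hc hM hθ1 hy hh hdec hvW hL hpos hlim has
  have hz : 0 ≤ k * (s - (a + 1)) := mul_nonneg hk.le (by linarith)
  refine h2.trans ?_
  rw [mul_assoc, Real.mul_rpow (by positivity) hz]
  have e1 : (C ^ (-(1 / p))) ^ (-p) = C := by
    rw [← Real.rpow_mul hC.le]; field_simp; simp
  rw [e1]
  refine mul_le_mul_of_nonneg_left ?_ hC.le
  calc h s ^ (1 - θ) ≤ ((k * (s - (a + 1))) ^ (-(1 / q))) ^ (1 - θ) :=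
        Real.rpow_le_rpow (hpos s has).le h1 h1θ.le
    _ = _ := by rw [← Real.rpow_mul hz]; congr 1; rw [hp_def]; field_simp

end UnboundedDamping

/-! ### A Lyapunov function for the damped gradient system. -/

namespace UnboundedDamping

-- The left side is the derivative of `g(y + β v) + ‖v‖² / (2 μ)`, with `G`, `G₁` the gradients at
-- `y` and `y + β v`. The plain energy dissipates only `‖v‖²`; the shift by `β v` adds `-β μ ‖G‖²`.
-- Young's inequality absorbs the cross terms, and `hsmall` keeps their cost below half of the
-- friction `b₀ / μ`.
open scoped RealInnerProductSpace in
theorem lyapunov_deriv_le {F : Type*} [NormedAddCommGroup F] [InnerProductSpace ℝ F]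
    {v G G₁ : F} {L β b b₀ b₁ μ : ℝ} (hL : 0 ≤ L) (hβ : 0 < β) (hβ1 : β ≤ 1) (hμ : 0 < μ)
    (hb : b₀ ≤ b) (hb1 : b ≤ b₁) (hb0 : 0 < b₀) (hG : ‖G₁ - G‖ ≤ L * (β * ‖v‖))
    (hsmall : β * ((b₁ + L * μ) ^ 2 / (2 * μ) + L * (1 + b₁)) ≤ b₀ / (2 * μ)) :
    ⟪G₁, v + β • (-(b • v) - μ • G)⟫ + 1 / μ * ⟪v, -(b • v) - μ • G⟫ ≤
      -(β * μ / 2) * ‖G‖ ^ 2 - b₀ / (2 * μ) * ‖v‖ ^ 2 := by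
  -- Writing `G₁ = (G₁ - G) + G` cancels the `⟪G, v⟫` terms of order one in `β`-free form.
  have e : ⟪G₁, v + β • (-(b • v) - μ • G)⟫ + 1 / μ * ⟪v, -(b • v) - μ • G⟫ =
      ⟪G₁ - G, (1 - β * b) • v - (β * μ) • G⟫ - β * b * ⟪G, v⟫ - β * μ * ‖G‖ ^ 2
        - b / μ * ‖v‖ ^ 2 := by
    simp only [inner_add_right, inner_sub_right, inner_smul_right, inner_neg_right,
      inner_sub_left, real_inner_self_eq_norm_sq, real_inner_comm v G]
    field_simp
    ring
  have hbpos : 0 < b := hb0.trans_le hb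
  have hβb : β * b ≤ b₁ := by nlinarith
  have n1 : ‖(1 - β * b) • v - (β * μ) • G‖ ≤ (1 + b₁) * ‖v‖ + β * μ * ‖G‖ := by
    refine (norm_sub_le _ _).trans ?_
    rw [norm_smul, norm_smul, Real.norm_of_nonneg (by positivity : 0 ≤ β * μ), Real.norm_eq_abs]
    gcongr
    rw [abs_le]
    constructor <;> nlinarith [mul_pos hβ hbpos]
  have i1 : ⟪G₁ - G, (1 - β * b) • v - (β * μ) • G⟫ ≤
      L * (β * ‖v‖) * ((1 + b₁) * ‖v‖ + β * μ * ‖G‖) :=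
    (real_inner_le_norm _ _).trans (by gcongr)
  have i2 : -⟪G, v⟫ ≤ ‖G‖ * ‖v‖ := (neg_le_abs _).trans (abs_real_inner_le_norm _ _)
  have i3 : -(β * b * ⟪G, v⟫) ≤ β * b₁ * (‖G‖ * ‖v‖) := by
    calc -(β * b * ⟪G, v⟫) = β * b * (-⟪G, v⟫) := by ring
      _ ≤ β * b * (‖G‖ * ‖v‖) := by gcongr
      _ ≤ _ := by gcongr
  have i4 : L * (β * ‖v‖) * (β * μ * ‖G‖) ≤ β * (L * μ) * (‖G‖ * ‖v‖) := by
    have : L * (β * ‖v‖) * (β * μ * ‖G‖) = β * (β * (L * μ * (‖G‖ * ‖v‖))) := by ring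
    have h0 : 0 ≤ L * μ * (‖G‖ * ‖v‖) := by positivity
    calc _ = β * (β * (L * μ * (‖G‖ * ‖v‖))) := this
      _ ≤ β * (L * μ * (‖G‖ * ‖v‖)) := by
        exact mul_le_mul_of_nonneg_left (mul_le_of_le_one_left h0 hβ1) hβ.le
      _ = _ := by ring
  have i5 : b₀ / μ * ‖v‖ ^ 2 ≤ b / μ * ‖v‖ ^ 2 := by gcongr
  have i6 : (b₁ + L * μ) * (‖G‖ * ‖v‖) ≤
      μ / 2 * ‖G‖ ^ 2 + (b₁ + L * μ) ^ 2 / (2 * μ) * ‖v‖ ^ 2 := by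
    have : μ / 2 * ‖G‖ ^ 2 + (b₁ + L * μ) ^ 2 / (2 * μ) * ‖v‖ ^ 2 -
        (b₁ + L * μ) * (‖G‖ * ‖v‖) = (μ * ‖G‖ - (b₁ + L * μ) * ‖v‖) ^ 2 / (2 * μ) := by
      field_simp; ring
    have h2 : 0 ≤ (μ * ‖G‖ - (b₁ + L * μ) * ‖v‖) ^ 2 / (2 * μ) := by positivity
    linarith
  have i7 := mul_le_mul_of_nonneg_left i6 hβ.le
  have i8 := mul_le_mul_of_nonneg_right hsmall (sq_nonneg ‖v‖)
  have i9 : b₀ / μ = 2 * (b₀ / (2 * μ)) := by field_simp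
  rw [i9] at i5
  rw [e]
  nlinarith

/-- The velocity of a convergent trajectory of a damped gradient system tends to `0`. -/
theorem tendsto_norm_sq_zero_of_energy {f E E' w : ℝ → ℝ} {a k m : ℝ} (hk : 0 < k) (hm : 0 < m)
    (hE : ∀ s > a, HasDerivAt E (E' s) s) (hE' : ∀ s > a, E' s ≤ -k * w s)
    (hw : ∀ s, 0 ≤ w s) (heq : ∀ s, E s = f s + m * w s) {ℓ : ℝ}
    (hf : Tendsto f atTop (𝓝 ℓ)) : Tendsto w atTop (𝓝 0) := by
  have hanti : AntitoneOn E (Ioi a) := antitoneOn_Ioi_of_hasDerivAt hE fun s hs =>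
    (hE' s hs).trans (by nlinarith [hw s])
  rw [Metric.tendsto_atTop]
  intro ε hε
  obtain ⟨S, hS⟩ := Metric.tendsto_atTop.1 hf (m * ε / 4) (by positivity)
  set S₁ := max S (a + 1)
  have haS : a < S₁ := lt_of_lt_of_le (lt_add_one a) (le_max_right _ _)
  -- If `w` stayed above `ε / 2`, `E` would fall linearly to `-∞`, although it is bounded below
  -- because `f` converges and `w ≥ 0`.
  have hexists : ∃ T > S₁, w T < ε / 2 := by
    by_contra hcon
    push Not at hcon
    have hd : ∀ s > S₁, HasDerivAt (fun s => E s + k * (ε / 2) * s) (E' s + k * (ε / 2) * 1) s :=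
      fun s hs => (hE s (haS.trans hs)).add ((hasDerivAt_id s).const_mul _)
    have han := antitoneOn_Ioi_of_hasDerivAt hd fun s hs => by
      have h1 := hE' s (haS.trans hs)
      have h2 := hcon s hs
      nlinarith
    have hbd : ∀ s > S₁ + 1, k * (ε / 2) * s ≤
        E (S₁ + 1) + k * (ε / 2) * (S₁ + 1) - ℓ + m * ε / 4 := fun s hs => by
      have h1 := han (mem_Ioi.2 (lt_add_one S₁)) (mem_Ioi.2 ((lt_add_one S₁).trans hs)) hs.le
      have h2 := hS s ((le_max_left S (a + 1)).trans ((lt_add_one S₁).trans hs).le)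
      rw [Real.dist_eq, abs_lt] at h2
      have h3 := heq s
      have h4 := mul_nonneg hm.le (hw s)
      simp only at h1
      linarith
    have hkε : 0 < k * (ε / 2) := by positivity
    obtain ⟨s, hs1, hs2⟩ := ((eventually_gt_atTop (S₁ + 1)).and
      ((tendsto_id.const_mul_atTop hkε).eventually_gt_atTop
        (E (S₁ + 1) + k * (ε / 2) * (S₁ + 1) - ℓ + m * ε / 4))).exists
    exact absurd (hbd s hs1) (not_le.2 hs2)
  obtain ⟨T, hT, hwT⟩ := hexists
  refine ⟨T, fun s hs => ?_⟩
  rw [Real.dist_eq, sub_zero, abs_of_nonneg (hw s)]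
  -- Monotonicity of `E` carries smallness of `w` from `T` to all later times, up to the oscillation
  -- of `f`.
  have h1 := hanti (haS.trans hT) (mem_Ioi.2 ((haS.trans hT).trans_le hs)) hs
  have h2 := hS T ((le_max_left S (a + 1)).trans hT.le)
  have h3 := hS s ((le_max_left S (a + 1)).trans (hT.le.trans hs))
  rw [Real.dist_eq, abs_lt] at h2 h3
  rw [heq s, heq T] at h1
  have h4 : m * w s < m * ε := by nlinarith
  exact lt_of_mul_lt_mul_left h4 hm.le

open scoped RealInnerProductSpace in
theorem hasDerivAt_norm_sq {F : Type*} [NormedAddCommGroup F] [InnerProductSpace ℝ F]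
    {v : ℝ → F} {v' : F} {s : ℝ} (hv : HasDerivAt v v' s) :
    HasDerivAt (fun s => ‖v s‖ ^ 2) (2 * ⟪v s, v'⟫) s := by
  simpa using hv.norm_sq

section System

variable {F : Type*} [NormedAddCommGroup F] [InnerProductSpace ℝ F] [CompleteSpace F]

open scoped RealInnerProductSpace in
theorem hasDerivAt_comp_of_differentiable {g : F → ℝ} (hg : Differentiable ℝ g) {y : ℝ → F} {v : F}
    {s : ℝ} (hy : HasDerivAt y v s) : HasDerivAt (fun s => g (y s)) ⟪gradient g (y s), v⟫ s := by
  have := ((hg (y s)).hasGradientAt.hasFDerivAt).comp_hasDerivAt s hy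
  simpa [Function.comp_def] using this

/-- A Lyapunov function for a convergent trajectory of the damped system
`y'' + b(s) y' + μ ∇g(y) = 0`, satisfying a Łojasiewicz inequality. -/
theorem exists_lyapunov {g : F → ℝ} {L : NNReal} (hg : Differentiable ℝ g)
    (hLip : LipschitzWith L (gradient g)) {y v : ℝ → F} {b : ℝ → ℝ} {a b₀ b₁ μ θ : ℝ} {z : F}
    (hμ : 0 < μ) (hb0 : 0 < b₀) (hb : ∀ s > a, b₀ ≤ b s) (hb1 : ∀ s > a, b s ≤ b₁)
    (hy : ∀ s > a, HasDerivAt y (v s) s)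
    (hv : ∀ s > a, HasDerivAt v (-(b s • v s) - μ • gradient g (y s)) s)
    (hlim : Tendsto y atTop (𝓝 z)) (hθ : 1 / 2 ≤ θ) (hθ1 : θ < 1)
    (hLoj : ∃ K > (0 : ℝ), ∃ ε > (0 : ℝ), ∀ x : F,
      ‖x - z‖ < ε → |g x - g z| ^ θ ≤ K * ‖gradient g x‖) :
    ∃ (h h' W : ℝ → ℝ) (A c M : ℝ), a ≤ A ∧ 0 < c ∧ 0 < M ∧
      (∀ s > A, HasDerivAt h (h' s) s) ∧ (∀ s > A, h' s ≤ -c * W s ^ 2) ∧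
      (∀ s > A, ‖v s‖ ≤ W s) ∧ (∀ s > A, h s ^ θ ≤ M * W s) ∧ Tendsto h atTop (𝓝 0) := by
  obtain ⟨K, hK, ε, hε, hLoj⟩ := hLoj
  have hL : 0 ≤ (L : ℝ) := L.2
  have hgc : Continuous g := hg.continuous
  -- the velocity tends to zero
  have hvsq : Tendsto (fun s => ‖v s‖ ^ 2) atTop (𝓝 0) := by
    refine tendsto_norm_sq_zero_of_energy (f := fun s => g (y s)) (a := a)
      (E := fun s => g (y s) + 1 / (2 * μ) * ‖v s‖ ^ 2)
      (k := b₀ / μ) (m := 1 / (2 * μ)) (by positivity) (by positivity)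
      (fun s hs => (hasDerivAt_comp_of_differentiable hg (hy s hs)).add
        ((hasDerivAt_norm_sq (hv s hs)).const_mul _)) ?_ (fun s => sq_nonneg _) (fun s => rfl)
      ((hgc.tendsto z).comp hlim)
    intro s hs
    simp only [inner_sub_right, inner_neg_right, inner_smul_right, real_inner_self_eq_norm_sq,
      real_inner_comm (v s) (gradient g (y s))]
    have h1 : b₀ / μ * ‖v s‖ ^ 2 ≤ b s / μ * ‖v s‖ ^ 2 := by gcongr; exact hb s hs
    have h2 : 1 / (2 * μ) * (2 * (-(b s * ‖v s‖ ^ 2) - μ * inner ℝ (gradient g (y s)) (v s))) =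
        -(b s / μ * ‖v s‖ ^ 2) - inner ℝ (gradient g (y s)) (v s) := by field_simp
    rw [real_inner_comm] at h2
    linarith
  have hv0 : Tendsto v atTop (𝓝 0) := by
    rw [tendsto_zero_iff_norm_tendsto_zero]
    have := hvsq.sqrt
    simpa [Real.sqrt_sq (norm_nonneg _)] using this
  have hb1pos : 0 < b₁ := hb0.trans_le ((hb (a + 1) (by linarith)).trans (hb1 (a + 1) (by linarith)))
  -- the parameter `β`
  set B := (b₁ + L * μ) ^ 2 / (2 * μ) + L * (1 + b₁) with hB
  have hBpos : 0 < B := by positivity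
  set r := b₀ / (2 * μ) with hr
  have hrpos : 0 < r := by positivity
  obtain ⟨β, hβ, hβ1, hβB⟩ : ∃ β : ℝ, 0 < β ∧ β ≤ 1 ∧ β * B ≤ r := by
    refine ⟨min 1 (r / B), lt_min one_pos (by positivity), min_le_left _ _, ?_⟩
    calc min 1 (r / B) * B ≤ r / B * B := by gcongr; exact min_le_right _ _
      _ = r := by field_simp
  have hyβ : Tendsto (fun s => y s + β • v s) atTop (𝓝 z) := by
    simpa using hlim.add (hv0.const_smul β)
  -- Past `A₁` the shifted point lies in the Łojasiewicz ball and `‖v‖ < 1`.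
  obtain ⟨A₁, hA₁⟩ := eventually_atTop.1
    (((hyβ.eventually (Metric.ball_mem_nhds z hε)).and
      (hv0.eventually (Metric.ball_mem_nhds 0 one_pos))))
  set p := min (β * μ / 2) r with hp
  have hppos : 0 < p := lt_min (by positivity) hrpos
  -- The rate `p / 2` comes from `(X + Y)² ≤ 2 (X² + Y²)`.
  refine ⟨fun s => g (y s + β • v s) - g z + 1 / (2 * μ) * ‖v s‖ ^ 2,
    fun s => inner ℝ (gradient g (y s + β • v s))
        (v s + β • (-(b s • v s) - μ • gradient g (y s))) +
      1 / (2 * μ) * (2 * inner ℝ (v s) (-(b s • v s) - μ • gradient g (y s))),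
    fun s => ‖gradient g (y s)‖ + ‖v s‖, max a A₁, p / 2,
    K * (1 + L * β) + (1 / (2 * μ)) ^ θ, le_max_left _ _, by positivity, by positivity,
    ?_, ?_, ?_, ?_, ?_⟩
  · intro s hs
    have hs' : a < s := (le_max_left _ _).trans_lt hs
    exact ((hasDerivAt_comp_of_differentiable hg
      ((hy s hs').add ((hv s hs').const_smul β))).sub_const _).add
        ((hasDerivAt_norm_sq (hv s hs')).const_mul _)
  · intro s hs
    have hs' : a < s := (le_max_left _ _).trans_lt hs
    have hG : ‖gradient g (y s + β • v s) - gradient g (y s)‖ ≤ L * (β * ‖v s‖) := by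
      have := hLip.norm_sub_le (y s + β • v s) (y s)
      rwa [add_sub_cancel_left, norm_smul, Real.norm_of_nonneg hβ.le] at this
    have h1 := lyapunov_deriv_le hL hβ hβ1 hμ (hb s hs') (hb1 s hs') hb0 hG hβB
    have h2 : 1 / (2 * μ) * (2 * inner ℝ (v s) (-(b s • v s) - μ • gradient g (y s))) =
        1 / μ * inner ℝ (v s) (-(b s • v s) - μ • gradient g (y s)) := by field_simp
    simp only
    rw [h2]
    refine h1.trans ?_
    have h3 : p * ‖gradient g (y s)‖ ^ 2 ≤ β * μ / 2 * ‖gradient g (y s)‖ ^ 2 := by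
      gcongr; exact min_le_left _ _
    have h4 : p * ‖v s‖ ^ 2 ≤ r * ‖v s‖ ^ 2 := by
      gcongr; exact min_le_right _ _
    nlinarith [mul_nonneg hppos.le (sq_nonneg (‖gradient g (y s)‖ - ‖v s‖))]
  · intro s _
    exact le_add_of_nonneg_left (norm_nonneg _)
  · intro s hs
    have hs' : a < s := (le_max_left _ _).trans_lt hs
    obtain ⟨hn1, hn2⟩ := hA₁ s (((le_max_right _ _).trans_lt hs).le)
    rw [dist_eq_norm] at hn1
    rw [dist_zero_right] at hn2
    have h1 := hLoj _ hn1
    have hG : ‖gradient g (y s + β • v s)‖ ≤ ‖gradient g (y s)‖ + L * (β * ‖v s‖) := by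
      have := hLip.norm_sub_le (y s + β • v s) (y s)
      rw [add_sub_cancel_left, norm_smul, Real.norm_of_nonneg hβ.le] at this
      linarith [norm_le_norm_add_norm_sub' (gradient g (y s + β • v s)) (gradient g (y s))]
    have hθ0 : 0 ≤ θ := by linarith
    simp only
    set δ := g (y s + β • v s) - g z
    have h2 : (δ + 1 / (2 * μ) * ‖v s‖ ^ 2) ^ θ ≤
        |δ| ^ θ + (1 / (2 * μ)) ^ θ * ‖v s‖ := by
      have hq : 0 ≤ 1 / (2 * μ) * ‖v s‖ ^ 2 := by positivity
      -- Here `θ ≥ 1/2` enters: `2θ ≥ 1` and `‖v‖ < 1`.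
      have e2 : (‖v s‖ ^ 2) ^ θ ≤ ‖v s‖ := by
        rw [← Real.rpow_natCast, ← Real.rpow_mul (norm_nonneg _)]
        calc ‖v s‖ ^ (((2 : ℕ) : ℝ) * θ) ≤ ‖v s‖ ^ (1 : ℝ) := by
              refine Real.rpow_le_rpow_of_exponent_ge_of_imp (norm_nonneg _) hn2.le ?_ ?_
              · push_cast; linarith
              · intro _ h; exact absurd h (by norm_num; linarith)
          _ = _ := Real.rpow_one _
      calc (δ + 1 / (2 * μ) * ‖v s‖ ^ 2) ^ θ ≤ |δ + 1 / (2 * μ) * ‖v s‖ ^ 2| ^ θ :=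
            (le_abs_self _).trans (Real.abs_rpow_le_abs_rpow _ _)
        _ ≤ (|δ| + 1 / (2 * μ) * ‖v s‖ ^ 2) ^ θ := by
            refine Real.rpow_le_rpow (abs_nonneg _) ((abs_add_le _ _).trans ?_) hθ0
            rw [abs_of_nonneg hq]
        _ ≤ |δ| ^ θ + (1 / (2 * μ) * ‖v s‖ ^ 2) ^ θ :=
            Real.rpow_add_le_add_rpow (abs_nonneg _) hq hθ0 hθ1.le
        _ ≤ _ := by
            rw [Real.mul_rpow (by positivity) (by positivity)]
            gcongr
    have h3 : K * ‖gradient g (y s + β • v s)‖ ≤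
        K * (‖gradient g (y s)‖ + L * (β * ‖v s‖)) := by gcongr
    set X := ‖gradient g (y s)‖
    set Y := ‖v s‖
    have hX : 0 ≤ X := norm_nonneg _
    have hY : 0 ≤ Y := norm_nonneg _
    have p1 : 0 ≤ K * (L * β) * X := by positivity
    have p2 : 0 ≤ K * Y := by positivity
    have p3 : 0 ≤ (1 / (2 * μ)) ^ θ * X := by positivity
    linarith
  · have h1 : Tendsto (fun s => g (y s + β • v s) - g z + 1 / (2 * μ) * ‖v s‖ ^ 2) atTop
        (𝓝 (g z - g z + 1 / (2 * μ) * 0)) :=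
      (((hgc.tendsto z).comp hyβ).sub_const _).add (hvsq.const_mul _)
    simpa using h1

end System

end UnboundedDamping

/-! ### Strong solutions and the change of time. -/

namespace UnboundedDamping

section StrongSolution

variable {n : ℕ} {g : EuclideanSpace ℝ (Fin n) → ℝ} {lam γ t₀ : ℝ}
  {u₀ v₀ : EuclideanSpace ℝ (Fin n)} {x : ℝ → EuclideanSpace ℝ (Fin n)}

theorem LocallyAbsolutelyContinuousFrom.continuousOn {f : ℝ → EuclideanSpace ℝ (Fin n)}
    (hf : LocallyAbsolutelyContinuousFrom t₀ f) : ContinuousOn f (Ioi t₀) := by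
  intro t ht
  have h1 := (hf (t + 1) (by have := mem_Ioi.1 ht; linarith)).continuousOn
  rw [uIcc_of_le (by have := mem_Ioi.1 ht; linarith)] at h1
  exact (h1.continuousAt (Icc_mem_nhds ht (lt_add_one t))).continuousWithinAt

theorem hasDerivAt_vel {f : ℝ → EuclideanSpace ℝ (Fin n)} (hf : DifferentiableOn ℝ f (Ici t₀))
    {t : ℝ} (ht : t₀ < t) : HasDerivAt f (vel t₀ f t) t :=
  (hf t ht.le).hasDerivWithinAt.hasDerivAt (Ici_mem_nhds ht)

/-- Along a strong solution the equation holds at every time, not only almost everywhere. -/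
theorem IsStrongGlobalSolution.ode_everywhere (hx : IsStrongGlobalSolution g lam γ t₀ u₀ v₀ x)
    (ht₀ : 0 < t₀) (hgrad : Continuous (gradient g)) {t : ℝ} (ht : t₀ < t) :
    (lam / t ^ 2) • acc t₀ x t + (γ / t) • vel t₀ x t + gradient g (x t) = 0 := by
  have hne : ∀ t ∈ Ioi t₀, t ≠ 0 := fun t ht => (ht₀.trans ht).ne'
  have hae : (fun t => (lam / t ^ 2) • acc t₀ x t + (γ / t) • vel t₀ x t + gradient g (x t))
      =ᵐ[volume.restrict (Ioi t₀)] fun _ => 0 := by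
    have := hx.ode
    exact ae_restrict_of_ae_restrict_of_subset Ioi_subset_Ici_self this
  -- Both sides are continuous on the open half-line, `acc` by its local absolute continuity.
  refine Measure.eqOn_of_ae_eq hae ?_ continuousOn_const
    (by rw [interior_Ioi]; exact subset_closure) ht
  refine ContinuousOn.add (ContinuousOn.add ?_ ?_) ?_
  · exact (continuousOn_const.div (by fun_prop) fun t ht => pow_ne_zero 2 (hne t ht)).smul
      hx.locAC_acc.continuousOn
  · exact (continuousOn_const.div continuousOn_id hne).smul hx.locAC_vel.continuousOn
  · exact hgrad.comp_continuousOn hx.locAC.continuousOn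

theorem hasDerivAt_sqrt_two_mul {s : ℝ} (hs : 0 < s) :
    HasDerivAt (fun s : ℝ => √(2 * s)) (1 / √(2 * s)) s := by
  have h := ((hasDerivAt_id s).const_mul 2).sqrt (by simp only [id]; positivity)
  simp only [id] at h
  convert h using 1
  field_simp

/-- In the time variable `s = t² / 2` a strong solution solves a heavy ball system with damping
coefficient `γ / lam + 1 / (2 s)`. -/
theorem IsStrongGlobalSolution.hasDerivAt_rescaled
    (hx : IsStrongGlobalSolution g lam γ t₀ u₀ v₀ x) (hlam : 0 < lam) (ht₀ : 0 < t₀)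
    (hgrad : Continuous (gradient g)) {s : ℝ} (hs : t₀ ^ 2 / 2 < s) :
    HasDerivAt (fun s => x √(2 * s)) ((1 / √(2 * s)) • vel t₀ x √(2 * s)) s ∧
    HasDerivAt (fun s => (1 / √(2 * s)) • vel t₀ x √(2 * s))
      (-((γ / lam + 1 / (2 * s)) • ((1 / √(2 * s)) • vel t₀ x √(2 * s)))
        - (1 / lam) • gradient g (x √(2 * s))) s := by
  have hs0 : 0 < s := lt_of_le_of_lt (by positivity) hs
  have ht : t₀ < √(2 * s) := Real.lt_sqrt_of_sq_lt (by linarith)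
  have hτ := hasDerivAt_sqrt_two_mul hs0
  have h1 := (hasDerivAt_vel hx.differentiableOn ht).scomp s hτ
  have h2 := (hasDerivAt_vel hx.differentiableOn_vel ht).scomp s hτ
  have htpos : 0 < √(2 * s) := ht₀.trans ht
  refine ⟨h1, ?_⟩
  have h3 : HasDerivAt (fun s : ℝ => 1 / √(2 * s)) (-(1 / √(2 * s)) / √(2 * s) ^ 2) s := by
    simp only [one_div] at hτ ⊢
    exact hτ.inv htpos.ne'
  refine (h3.smul h2).congr_deriv ?_
  have hode := hx.ode_everywhere ht₀ hgrad ht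
  have hsq : 2 * s = √(2 * s) ^ 2 := (Real.sq_sqrt (by positivity)).symm
  simp only [Function.comp_apply]
  change _ • (1 / √(2 * s)) • acc t₀ x √(2 * s) + _ = _
  have hacc : acc t₀ x √(2 * s) = -((√(2 * s) ^ 2 / lam) •
      ((γ / √(2 * s)) • vel t₀ x √(2 * s) + gradient g (x √(2 * s)))) := by
    rw [add_assoc] at hode
    rw [eq_neg_of_add_eq_zero_right hode, smul_neg, neg_neg, smul_smul]
    rw [show √(2 * s) ^ 2 / lam * (lam / √(2 * s) ^ 2) = 1 by field_simp, one_smul]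
  rw [hacc, show (1 : ℝ) / (2 * s) = 1 / √(2 * s) ^ 2 by rw [← hsq]]
  generalize √(2 * s) = t at htpos ⊢
  match_scalars <;> field_simp
  all_goals ring

end StrongSolution

end UnboundedDamping

/-! ### Rates in the original time. -/

open UnboundedDamping in
theorem corollary5p2 {n : ℕ} (g : EuclideanSpace ℝ (Fin n) → ℝ) (Lg : NNReal)
    (hg : Differentiable ℝ g) (hLip : LipschitzWith Lg (gradient g))
    (hbdd : BddBelow (Set.range g))
    (lam γ t₀ : ℝ) (hlam : 0 < lam) (hγ : 0 < γ) (ht₀ : 0 < t₀)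
    (u₀ v₀ : EuclideanSpace ℝ (Fin n)) (x : ℝ → EuclideanSpace ℝ (Fin n))
    (hx : UnboundedDamping.IsStrongGlobalSolution g lam γ t₀ u₀ v₀ x)
    (hxbdd : Bornology.IsBounded (x '' Set.Ici t₀))
    (xbar : EuclideanSpace ℝ (Fin n)) (hcrit : xbar ∈ UnboundedDamping.crit g)
    (hlim : Filter.Tendsto x Filter.atTop (nhds xbar))
    (θ : ℝ) (hθ : θ ∈ Set.Ico (1 / 2 : ℝ) 1)
    (hLoj : UnboundedDamping.HasLojasiewiczExponentAt g xbar θ) :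
    (θ = 1 / 2 → ∃ a₁ > (0 : ℝ), ∃ a₂ > (0 : ℝ), ∃ t' ≥ t₀, ∀ t ≥ t',
      ‖x t - xbar‖ ≤ a₁ * Real.exp (-a₂ * t ^ 2)) ∧
    (1 / 2 < θ → ∃ a₃ > (0 : ℝ), ∃ a₄ > (0 : ℝ), ∃ t' ≥ t₀, ∀ t ≥ t',
      ‖x t - xbar‖ ≤ (a₃ * t ^ 2 + a₄) ^ (-((1 - θ) / (2 * θ - 1)))) := by
  have hgrad := hLip.continuous
  have hsys := fun s (hs : s > t₀ ^ 2 / 2) =>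
    hx.hasDerivAt_rescaled hlam ht₀ hgrad hs
  have hsqrt : Tendsto (fun s : ℝ => √(2 * s)) atTop atTop :=
    Real.tendsto_sqrt_atTop.comp (tendsto_id.const_mul_atTop two_pos)
  have hylim : Tendsto (fun s => x √(2 * s)) atTop (𝓝 xbar) := hlim.comp hsqrt
  have hpos : ∀ s > t₀ ^ 2 / 2, 0 < s := fun s hs => lt_of_le_of_lt (by positivity) hs
  obtain ⟨h, h', W, A, c, M, hA, hc, hM, hh, hdec, hvW, hL, h0⟩ :=
    exists_lyapunov (b := fun s => γ / lam + 1 / (2 * s)) (b₀ := γ / lam)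
      (b₁ := γ / lam + 1 / t₀ ^ 2) hg hLip (one_div_pos.2 hlam)
      (div_pos hγ hlam)
      (fun s hs => le_add_of_nonneg_right (by have := hpos s hs; positivity))
      (fun s hs => by
        have : t₀ ^ 2 ≤ 2 * s := by linarith
        gcongr)
      (fun s hs => (hsys s hs).1) (fun s hs => (hsys s hs).2) hylim hθ.1 hθ.2 hLoj.2
  have hy := fun s (hs : s > A) => (hsys s (lt_of_le_of_lt hA hs)).1
  have hback : ∀ t ≥ t₀, √(2 * (t ^ 2 / 2)) = t := fun t ht => by
    rw [mul_div_cancel₀ _ two_ne_zero, Real.sqrt_sq (ht₀.le.trans ht)]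
  have htq : Tendsto (fun t : ℝ => t ^ 2) atTop atTop := tendsto_pow_atTop two_ne_zero
  constructor
  · rintro rfl
    obtain ⟨C, hC, k, hk, S, hS⟩ := exp_rate_of_lojasiewicz hc hM hy hh hdec hvW hL h0 hylim
    obtain ⟨t', ht'⟩ := eventually_atTop.1 (htq.eventually_gt_atTop (2 * S))
    refine ⟨C, hC, k / 2, half_pos hk, max t₀ t', le_max_left _ _, fun t ht => ?_⟩
    have h1 := hS (t ^ 2 / 2) (by have := ht' t ((le_max_right _ _).trans ht); linarith)
    simp only [hback t ((le_max_left _ _).trans ht)] at h1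
    convert h1 using 3
    ring
  · intro hθ'
    obtain ⟨k, hk, S, hS⟩ := rpow_rate_of_lojasiewicz hc hM hθ' hθ.2 hy hh hdec hvW hL h0 hylim
    -- Beyond `4 (S + 1 / k)`, half of the slope `k / 2` in `t²` pays for the shift `-k S` and
    -- leaves the constant `1`.
    obtain ⟨t', ht'⟩ := eventually_atTop.1 ((htq.eventually_gt_atTop (2 * S)).and
      (htq.eventually_ge_atTop (4 * (S + 1 / k))))
    refine ⟨k / 4, by positivity, 1, one_pos, max t₀ t', le_max_left _ _, fun t ht => ?_⟩
    obtain ⟨h2, h3⟩ := ht' t ((le_max_right _ _).trans ht)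
    have h1 := hS (t ^ 2 / 2) (by linarith)
    simp only [hback t ((le_max_left _ _).trans ht)] at h1
    have h4 : k / 4 * t ^ 2 + 1 ≤ k * (t ^ 2 / 2 - S) := by
      have : k / 4 * (4 * (S + 1 / k)) ≤ k / 4 * t ^ 2 := by gcongr
      have e : k / 4 * (4 * (S + 1 / k)) = k * S + 1 := by field_simp
      linarith
    refine h1.trans (Real.rpow_le_rpow_of_nonpos (by positivity) h4 ?_)
    have : 0 ≤ (1 - θ) / (2 * θ - 1) := div_nonneg (by linarith [hθ.2]) (by linarith)
    linarith
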